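/- **Setting.** Let $d\ge 1$ and let $(X(t))_{t\in\mathbb{R}^d}$ be a (strictly) stationary, jointly measurable real-valued random field on a probability space $(\Omega,\mathcal A,\mathbb P)$, let $f_1,\dots,f_s:\mathbb{R}\to\mathbb{R}$ be measurable, and let $\lambda_d$ denote Lebesgue measure, $B^d$ the closed Euclidean unit ball of $\mathbb{R}^d$ and $\kappa_d=\lambda_d(B^d)$. Assume: (i) there is $\delta>0$ with $\mathbb{E}|f_i(X(0))|^{2+\delta}<\infty$ for all $i$; (ii) $\int_{\mathbb{R}^d}|\operatorname{Cov}(f_i(X(0)),f_j(X(t)))|\,dt<\infty$ for all $i,j$; (iii) there are $n\in\mathbb{N}$ and $C,l>0$ with $n/d>l+(2+\delta)/\delta$ such that $\alpha_\gamma(r)\le C r^{-n}\gamma^l$ for all $\gamma\ge 2\kappa_d$ and $r>0$. Here $\alpha_\gamma(r)$ is the supremum of $|\mathbb P(F\cap G)-\mathbb P(F)\mathbb P(G)|$ over all $F\in\sigma(X(t):t\in I)$ and $G\in\sigma(X(t):t\in J)$ and all $I,J\subseteq\mathbb{R}^d$ with $\lambda_d((I\cup J)+B^d)\le\gamma$ for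 which some unit vector $u$ satisfies $\min_{t\in I}\langle u,t\rangle-\max_{t\in J}\langle u,t\rangle>r$ (the minimum and maximum being attained). Let $\Sigma=(\sigma_{ij})_{i,j=1}^s$ with $\sigma_{ij}=\int_{\mathbb{R}^d}\operatorname{Cov}(f_i(X(0)),f_j(X(t)))\,dt$. A *Lévy–Meixner system* consists of probability measures $\Psi_\lambda$ on $\mathbb{R}$, $\lambda>0$, with all moments finite, and real polynomials $Q_n(\cdot;\lambda)$ of degree $n$, $n\ge 0$, such that for each $\lambda$ the $Q_n(\cdot;\lambda)$ are pairwise orthogonal with nonzero norms in $L^2(\Psi_\lambda)$, and such that there are open sets $U,V\subseteq\mathbb{R}$ containing $0$ and real-analytic functions $a:V\to U$, $b:U\to(0,\infty)$ with $a(0)=0$, $a'(0)\ne0$, $b(0)=1$ and $$\sum_{n\ge 0}Q_n(x;\lambda)\frac{z^n}{n!}=b(a(z))^{-\lambda}e^{x\,a(z)},\qquad x\in\mathbb{R},\ \lambda>0,\ z\in V.$$ A *Lévy–Meixner noise* is a family of real random variables $\Lambda(B)$, indexed by the Borel sets $B\subseteq\mathbb{R}^d$ with $\lambda_d(B)<\infty$,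 such that for some Lévy–Meixner system: $\Lambda(B)\sim\Psi_{\lambda_d(B)}$ whenever $0<\lambda_d(B)<\infty$; $\Lambda(B_1),\dots,\Lambda(B_k)$ are independent for pairwise disjoint $B_1,\dots,B_k$; and $\Lambda(\bigcup_i B_i)=\sum_{i=1}^{\infty}\Lambda(B_i)$ almost surely, for each sequence of pairwise disjoint Borel sets with $\lambda_d(\bigcup_i B_i)<\infty$. **Proposition.** Suppose in addition that either - $X$ is a centered Gaussian field with $\operatorname{Cov}(X(s),X(t))\ge0$ for all $s,t$, or - $X$ is a moving-window field driven by Lévy–Meixner noise: there are a Lévy–Meixner noise $\Lambda$ and a fixed Borel set $B\subseteq\mathbb{R}^d$ with $0<\lambda_d(B)<\infty$ such that $X(t)=\Lambda(B+t)$ almost surely for each $t\in\mathbb{R}^d$. Then: 1. For every $u\in\mathbb{R}^s$: if $\operatorname{Var}\big(\sum_{i=1}^s u_if_i(X(0))\big)>0$, then $u^T\Sigma u>0$. 2. For every $i$: if $\operatorname{Var}(f_i(X(0)))>0$, then $\sigma_{ii}>0$. 3. If $\operatorname{Var}\big(\sum_{i=1}^s u_if_i(X(0))\big)=0$ implies $u_1=\dots=u_s=0$,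 then $\Sigma$ is (symmetric and) positive definite. -/

import Mathlib

open MeasureTheory ProbabilityTheory Filter Topology

noncomputable section

namespace RandomFieldCLT

/-! ### Lévy–Meixner systems -/

/-- The polynomials `Q lam n` (`lam > 0`, `n = 0, 1, 2, …`) form a Lévy–Meixner system, with
associated probability measures `Psi lam`. For `lam ≤ 0` nothing is required of `Psi`, `Q`.

The leading coefficients are not normalized: by the generating function, the leading coefficient
of `Q lam n` is the `n`-th power of the derivative of `a` at `0`. -/
structure IsLevyMeixnerSystem (Psi : ℝ → Measure ℝ) (Q : ℝ → ℕ → Polynomial ℝ) : Prop where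
  isProbabilityMeasure : ∀ lam, 0 < lam → IsProbabilityMeasure (Psi lam)
  integrable_pow : ∀ lam, 0 < lam → ∀ n : ℕ, Integrable (fun x : ℝ => x ^ n) (Psi lam)
  degree_eq : ∀ lam, 0 < lam → ∀ n : ℕ, (Q lam n).degree = n
  orthogonal : ∀ lam, 0 < lam → ∀ m n : ℕ, m ≠ n →
    ∫ x, (Q lam m).eval x * (Q lam n).eval x ∂(Psi lam) = 0
  norm_pos : ∀ lam, 0 < lam → ∀ n : ℕ, 0 < ∫ x, (Q lam n).eval x ^ 2 ∂(Psi lam)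
  generating : ∃ (U V : Set ℝ) (a b : ℝ → ℝ),
    IsOpen U ∧ IsOpen V ∧ (0 : ℝ) ∈ U ∧ (0 : ℝ) ∈ V ∧
    Set.MapsTo a V U ∧ AnalyticOnNhd ℝ a V ∧ AnalyticOnNhd ℝ b U ∧
    (∀ t ∈ U, 0 < b t) ∧ a 0 = 0 ∧ deriv a 0 ≠ 0 ∧ b 0 = 1 ∧
    ∀ lam, 0 < lam → ∀ x : ℝ, ∀ z ∈ V,
      HasSum (fun n : ℕ => (Q lam n).eval x * (z ^ n / (n.factorial : ℝ)))
        ((b (a z)) ^ (-lam) * Real.exp (x * a z))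

variable {Ω : Type*} [MeasurableSpace Ω] {d : ℕ}

/-! ### Random fields on `ℝ^d` -/

/-- The field is measurable: `(t, ω) ↦ X t ω` is jointly measurable. -/
def IsMeasurableField (X : EuclideanSpace ℝ (Fin d) → Ω → ℝ) : Prop :=
  Measurable fun p : EuclideanSpace ℝ (Fin d) × Ω => X p.1 p.2

/-- The field is (strictly) stationary: all its finite-dimensional distributions are invariant
under translations of the index. -/
def IsStationaryField (P : Measure Ω) (X : EuclideanSpace ℝ (Fin d) → Ω → ℝ) : Prop :=
  ∀ (k : ℕ) (t : Fin k → EuclideanSpace ℝ (Fin d)) (h : EuclideanSpace ℝ (Fin d)),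
    P.map (fun ω (i : Fin k) => X (t i + h) ω) = P.map (fun ω (i : Fin k) => X (t i) ω)

/-- The field is Gaussian, centered, and has a nonnegative covariance function. -/
def IsCenteredGaussianNonnegCov (P : Measure Ω) (X : EuclideanSpace ℝ (Fin d) → Ω → ℝ) : Prop :=
  IsGaussianProcess X P ∧ (∀ t, ∫ ω, X t ω ∂P = 0) ∧ ∀ s t, 0 ≤ covariance (X s) (X t) P

/-! ### Lévy noise and moving-window fields -/

/-- `L` is a Lévy noise on `ℝ^d` with marginal laws `Psi`: an independently scattered random
signed measure, defined on the Borel sets of finite Lebesgue measure, such that `L B` has law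
`Psi (λ_d(B))` whenever `0 < λ_d(B) < ∞`. Countable additivity is almost sure, for each sequence of
disjoint sets separately, as is usual for Lévy noise (Gaussian noise has no version whose paths
are signed measures). -/
structure IsLevyNoise (P : Measure Ω) (Psi : ℝ → Measure ℝ)
    (L : Set (EuclideanSpace ℝ (Fin d)) → Ω → ℝ) : Prop where
  measurable : ∀ B, MeasurableSet B → volume B < ⊤ → Measurable (L B)
  additive : ∀ B : ℕ → Set (EuclideanSpace ℝ (Fin d)), (∀ i, MeasurableSet (B i)) →
    Pairwise (fun i j => Disjoint (B i) (B j)) → volume (⋃ i, B i) < ⊤ →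
    ∀ᵐ ω ∂P, Tendsto (fun N : ℕ => ∑ i ∈ Finset.range N, L (B i) ω) atTop (𝓝 (L (⋃ i, B i) ω))
  independent : ∀ (k : ℕ) (B : Fin k → Set (EuclideanSpace ℝ (Fin d))),
    (∀ i, MeasurableSet (B i)) → (∀ i, volume (B i) < ⊤) →
    Pairwise (fun i j => Disjoint (B i) (B j)) → iIndepFun (fun i => L (B i)) P
  law : ∀ B, MeasurableSet B → 0 < volume B → volume B < ⊤ →
    P.map (L B) = Psi (volume B).toReal

/-- `X` is a moving-window field driven by Lévy–Meixner noise: `X t = L (B + t)` almost surely for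
each `t`, for a fixed Borel set `B` with `0 < λ_d(B) < ∞`. -/
def IsLevyMeixnerField (P : Measure Ω) (X : EuclideanSpace ℝ (Fin d) → Ω → ℝ) : Prop :=
  ∃ (Psi : ℝ → Measure ℝ) (Q : ℝ → ℕ → Polynomial ℝ)
    (L : Set (EuclideanSpace ℝ (Fin d)) → Ω → ℝ) (B : Set (EuclideanSpace ℝ (Fin d))),
    IsLevyMeixnerSystem Psi Q ∧ IsLevyNoise P Psi L ∧
    MeasurableSet B ∧ 0 < volume B ∧ volume B < ⊤ ∧
    ∀ t, X t =ᵐ[P] L ((fun x => x + t) '' B)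

/-! ### Mixing -/

/-- The α-mixing coefficient of two σ-algebras. For a probability measure the set below is
nonempty and bounded by `1`, so the supremum is a genuine one. -/
def alphaCoeff (P : Measure Ω) (F G : MeasurableSpace Ω) : ℝ :=
  sSup {x : ℝ | ∃ A B : Set Ω, MeasurableSet[F] A ∧ MeasurableSet[G] B ∧
    x = |P.real (A ∩ B) - P.real A * P.real B|}

/-- The σ-algebra generated by the random variables `X t`, `t ∈ I`. -/
abbrev sigmaField (X : EuclideanSpace ℝ (Fin d) → Ω → ℝ) (I : Set (EuclideanSpace ℝ (Fin d))) :
    MeasurableSpace Ω :=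
  ⨆ t ∈ I, MeasurableSpace.comap (X t) inferInstance

/-- For some unit vector `u`, the minimum of `⟨u, ·⟩` over `I` exceeds its maximum over `J`
by more than `r`. -/
def IsSeparatedBy (r : ℝ) (I J : Set (EuclideanSpace ℝ (Fin d))) : Prop :=
  ∃ (u : EuclideanSpace ℝ (Fin d)) (m M : ℝ), ‖u‖ = 1 ∧
    IsLeast ((fun t => inner ℝ u t) '' I) m ∧ IsGreatest ((fun t => inner ℝ u t) '' J) M ∧
    r < m - M

open scoped Pointwise in
/-- The mixing coefficient `α_γ(r)` of the field `X`. -/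
def fieldAlpha (P : Measure Ω) (X : EuclideanSpace ℝ (Fin d) → Ω → ℝ) (gam r : ℝ) : ℝ :=
  sSup {x : ℝ | ∃ I J : Set (EuclideanSpace ℝ (Fin d)), IsSeparatedBy r I J ∧
    volume ((I ∪ J) + Metric.closedBall (0 : EuclideanSpace ℝ (Fin d)) 1) ≤ ENNReal.ofReal gam ∧
    x = alphaCoeff P (sigmaField X I) (sigmaField X J)}

/-- The volume `κ_d` of the `d`-dimensional closed Euclidean unit ball. -/
def unitBallVolume (d : ℕ) : ℝ :=
  (volume (Metric.closedBall (0 : EuclideanSpace ℝ (Fin d)) 1)).toReal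

/-- The mixing condition: `α_γ(r) ≤ C r^{-n} γ^l` for all `γ ≥ 2 κ_d`, `r > 0`, for some natural
`n` and some `C, l > 0` with `n / d > l + (2 + δ) / δ`. -/
def MixingCondition (P : Measure Ω) (X : EuclideanSpace ℝ (Fin d) → Ω → ℝ) (del : ℝ) : Prop :=
  ∃ (n : ℕ) (C l : ℝ), 0 < C ∧ 0 < l ∧ l + (2 + del) / del < (n : ℝ) / (d : ℝ) ∧
    ∀ gam r : ℝ, 2 * unitBallVolume d ≤ gam → 0 < r →
      fieldAlpha P X gam r ≤ C * (r ^ n)⁻¹ * gam ^ l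

/-! ### The asymptotic covariance matrix -/

/-- The matrix `Σ` with entries `∫ Cov(f_i(X(0)), f_j(X(t))) dt`. -/
def asympCov (P : Measure Ω) (X : EuclideanSpace ℝ (Fin d) → Ω → ℝ) {s : ℕ}
    (f : Fin s → ℝ → ℝ) : Matrix (Fin s) (Fin s) ℝ :=
  Matrix.of fun i j =>
    ∫ t, covariance (fun ω => f i (X 0 ω)) (fun ω => f j (X t ω)) P

end RandomFieldCLT

end

namespace RandomFieldCLT

/-! ### Vanishing of a mutually orthogonal measurable process -/

/-! Put `g = ∑ u_i f_i` and `K(t) = Cov(g(X 0), g(X t))`. By bilinearity the quadratic form of `Σ`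
at `u` is `∫ K`, so it suffices that `K ≥ 0` and that `∫ K = 0` forces `g(X 0)` to be almost surely
constant.

Nonnegativity: in both cases `(X 0, X t)` is distributed as `(U + W, V + W)` with `U`, `V`, `W`
independent and `U`, `V` of equal law (`exists_commonSummandLaw_of_gaussian_or_levyMeixner`).
Conditionally on `W` the two components are i.i.d., so `K(t)` is the variance of `E[g(U + W) | W]`
(`covariance_nonneg_of_commonSummand`).

Strict positivity: if `∫ K = 0`, then `K = 0` almost everywhere, and by stationarity the centered
variables `Z_t = g(X t) - m` satisfy, for each `s`, `E[Z_s Z_t] = 0` for almost every `t`. A jointly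
measurable process with this property and bounded second moments vanishes almost everywhere
(`ae_eq_zero_of_ae_orthogonal`), so the variance is zero. No continuity of `K` at `0` is invoked. -/

lemma ae_eq_zero_of_forall_setIntegral_prod_eq_zero {α β : Type*} [MeasurableSpace α]
    [MeasurableSpace β] {μ : Measure α} {ν : Measure β} [IsFiniteMeasure μ] [IsFiniteMeasure ν]
    {f : α × β → ℝ} (hf : Integrable f (μ.prod ν))
    (h : ∀ A B, MeasurableSet A → MeasurableSet B → ∫ x in A ×ˢ B, f x ∂(μ.prod ν) = 0) :
    f =ᵐ[μ.prod ν] 0 := by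
  refine hf.ae_eq_zero_of_forall_setIntegral_eq_zero fun S hS _ => ?_
  induction S, hS using MeasurableSpace.induction_on_inter generateFrom_prod.symm
    isPiSystem_prod with
  | empty => simp
  | basic S hS =>
    obtain ⟨A, hA, B, hB, rfl⟩ := hS
    exact h A B hA hB
  | compl S hS ih =>
    have h1 := integral_add_compl hS hf
    have h2 := h _ _ MeasurableSet.univ MeasurableSet.univ
    rw [Set.univ_prod_univ, setIntegral_univ] at h2
    have h3 := ih (measure_lt_top _ _)
    linarith
  | iUnion S hd hS ih =>
    rw [integral_iUnion hS hd hf.integrableOn]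
    simp [fun i => ih i (measure_lt_top _ _)]

/-- By Fubini, `E (∫_A Z_t dt)² = ∫_A ∫_A E[Z_s Z_t] dt ds = 0` for every measurable `A`. So `∫_A
Z_t dt = 0` almost surely, and `Z` integrates to zero over every rectangle `A × F`. The bound `C`
provides the integrability that Fubini needs. -/
lemma ae_eq_zero_of_ae_orthogonal {T Ω : Type*} [MeasurableSpace T] [MeasurableSpace Ω]
    {μ : Measure T} {P : Measure Ω} [IsFiniteMeasure μ] [IsProbabilityMeasure P]
    {Z : T → Ω → ℝ} (hZ : Measurable fun p : T × Ω => Z p.1 p.2)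
    (hL2 : ∀ t, MemLp (Z t) 2 P) (C : ℝ) (hC : ∀ t, ∫ ω, Z t ω ^ 2 ∂P ≤ C)
    (horth : ∀ s, ∀ᵐ t ∂μ, ∫ ω, Z s ω * Z t ω ∂P = 0) :
    (fun p : T × Ω => Z p.1 p.2) =ᵐ[μ.prod P] 0 := by
  have hsq : ∀ t, Integrable (fun ω => Z t ω ^ 2) P := fun t => (hL2 t).integrable_sq
  have hZ1 : Integrable (fun p : T × Ω => Z p.1 p.2) (μ.prod P) := by
    rw [integrable_prod_iff hZ.aestronglyMeasurable]
    refine ⟨.of_forall fun t => (hL2 t).integrable one_le_two, ?_⟩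
    refine Integrable.of_bound (hZ.norm.stronglyMeasurable.integral_prod_right.aestronglyMeasurable)
      (1 + C) (.of_forall fun t => ?_)
    rw [Real.norm_of_nonneg (integral_nonneg fun _ => norm_nonneg _)]
    calc ∫ ω, ‖Z t ω‖ ∂P ≤ ∫ ω, (1 + Z t ω ^ 2) ∂P := by
          refine integral_mono ((hL2 t).integrable one_le_two).norm
            ((integrable_const _).add (hsq t)) fun ω => ?_
          have := sq_abs (Z t ω)
          rw [Real.norm_eq_abs]
          nlinarith [sq_nonneg (|Z t ω| - 1), abs_nonneg (Z t ω)]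
      _ = 1 + ∫ ω, Z t ω ^ 2 ∂P := by
          rw [integral_add (integrable_const _) (hsq t)]; simp
      _ ≤ 1 + C := by linarith [hC t]
  refine ae_eq_zero_of_forall_setIntegral_prod_eq_zero hZ1 fun A F hA hF => ?_
  set ν := μ.restrict A with hν
  have hZ2 : Integrable (fun p : T × Ω => Z p.1 p.2) (ν.prod P) := by
    have := hZ1.integrableOn (s := A ×ˢ Set.univ)
    rwa [IntegrableOn, ← Measure.prod_restrict, Measure.restrict_univ] at this
  have hm3 : Measurable fun p : (T × T) × Ω => Z p.1.1 p.2 * Z p.1.2 p.2 :=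
    (hZ.comp ((measurable_fst.comp measurable_fst).prodMk measurable_snd)).mul
      (hZ.comp ((measurable_snd.comp measurable_fst).prodMk measurable_snd))
  have hprod : ∀ s t, Integrable (fun ω => Z s ω * Z t ω) P := fun s t =>
    (hL2 s).integrable_mul (hL2 t)
  have hZ3 : Integrable (fun p : (T × T) × Ω => Z p.1.1 p.2 * Z p.1.2 p.2)
      ((ν.prod ν).prod P) := by
    rw [integrable_prod_iff hm3.aestronglyMeasurable]
    refine ⟨.of_forall fun p => hprod p.1 p.2, ?_⟩
    refine Integrable.of_bound
      (hm3.norm.stronglyMeasurable.integral_prod_right.aestronglyMeasurable)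
      C (.of_forall fun p => ?_)
    rw [Real.norm_of_nonneg (integral_nonneg fun _ => norm_nonneg _)]
    calc ∫ ω, ‖Z p.1 ω * Z p.2 ω‖ ∂P ≤ ∫ ω, (Z p.1 ω ^ 2 + Z p.2 ω ^ 2) / 2 ∂P := by
          refine integral_mono (hprod _ _).norm (((hsq _).add (hsq _)).div_const 2) fun ω => ?_
          simp only [norm_mul, Real.norm_eq_abs]
          nlinarith [sq_nonneg (|Z p.1 ω| - |Z p.2 ω|), sq_abs (Z p.1 ω), sq_abs (Z p.2 ω)]
      _ = (∫ ω, Z p.1 ω ^ 2 ∂P + ∫ ω, Z p.2 ω ^ 2 ∂P) / 2 := by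
          rw [integral_div, integral_add (hsq _) (hsq _)]
      _ ≤ C := by linarith [hC p.1, hC p.2]
  have hS : (fun ω => ∫ t, Z t ω ∂ν) =ᵐ[P] 0 := by
    have heq : ∀ ω, (∫ t, Z t ω ∂ν) ^ 2 = ∫ p : T × T, Z p.1 ω * Z p.2 ω ∂(ν.prod ν) := by
      intro ω
      rw [sq, ← integral_prod_mul (fun t => Z t ω) (fun t => Z t ω)]
    have hint : Integrable (fun ω => (∫ t, Z t ω ∂ν) ^ 2) P := by
      simp_rw [heq]
      exact hZ3.integral_prod_right
    have hzero : ∫ ω, (∫ t, Z t ω ∂ν) ^ 2 ∂P = 0 := by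
      simp_rw [heq]
      rw [← integral_integral_swap (f := fun (p : T × T) ω => Z p.1 ω * Z p.2 ω) hZ3,
        integral_prod _ hZ3.integral_prod_left]
      refine integral_eq_zero_of_ae (.of_forall fun s => ?_)
      exact integral_eq_zero_of_ae (ae_restrict_of_ae (horth s))
    have := (integral_eq_zero_iff_of_nonneg (fun ω => sq_nonneg _) hint).1 hzero
    filter_upwards [this] with ω hω
    exact pow_eq_zero_iff two_ne_zero |>.1 hω
  rw [← Measure.prod_restrict, integral_prod_symm]
  · exact integral_eq_zero_of_ae (ae_restrict_of_ae hS)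
  · have := hZ1.integrableOn (s := A ×ˢ F)
    rwa [IntegrableOn, ← Measure.prod_restrict] at this

/-! ### Pairs with a common summand and exchangeable remainders -/

/-- The law of `(U + W, V + W)` for independent `U`, `V`, `W` where `U`, `V` have law `μ` and `W`
has law `ν`. -/
noncomputable def commonSummandLaw (μ ν : Measure ℝ) : Measure (ℝ × ℝ) :=
  ((μ.prod μ).prod ν).map fun p => (p.1.1 + p.2, p.1.2 + p.2)

lemma measurable_commonSummand :
    Measurable fun p : (ℝ × ℝ) × ℝ => (p.1.1 + p.2, p.1.2 + p.2) := by fun_prop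

/-- Given the common summand, the two components are independent and identically distributed. -/
lemma covariance_nonneg_of_commonSummand {Ω : Type*} [MeasurableSpace Ω] {P : Measure Ω}
    [IsProbabilityMeasure P] {μ ν : Measure ℝ} [IsProbabilityMeasure μ] [IsProbabilityMeasure ν]
    {X Y : Ω → ℝ} (hX : Measurable X) (hY : Measurable Y)
    (hlaw : P.map (fun ω => (X ω, Y ω)) = commonSummandLaw μ ν)
    {g : ℝ → ℝ} (hg : Measurable g)
    (hgX : MemLp (fun ω => g (X ω)) 2 P) (hgY : MemLp (fun ω => g (Y ω)) 2 P) :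
    0 ≤ covariance (fun ω => g (X ω)) (fun ω => g (Y ω)) P := by
  have hT := measurable_commonSummand
  have hXY : Measurable fun ω => (X ω, Y ω) := hX.prodMk hY
  have transfer : ∀ F : ℝ × ℝ → ℝ, Measurable F →
      ∫ ω, F (X ω, Y ω) ∂P = ∫ p, F (p.1.1 + p.2, p.1.2 + p.2) ∂((μ.prod μ).prod ν) := by
    intro F hF
    rw [← integral_map (f := F) hXY.aemeasurable hF.aestronglyMeasurable, hlaw, commonSummandLaw,
      integral_map hT.aemeasurable hF.aestronglyMeasurable]
  have transferI : ∀ F : ℝ × ℝ → ℝ, Measurable F → Integrable (fun ω => F (X ω, Y ω)) P →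
      Integrable (fun p : (ℝ × ℝ) × ℝ => F (p.1.1 + p.2, p.1.2 + p.2))
        ((μ.prod μ).prod ν) := by
    intro F hF hI
    have h1 := (integrable_map_measure hF.aestronglyMeasurable hXY.aemeasurable).2 hI
    rw [hlaw, commonSummandLaw] at h1
    exact (integrable_map_measure hF.aestronglyMeasurable hT.aemeasurable).1 h1
  have hm1 : Measurable fun q : ℝ × ℝ => g q.1 := hg.comp measurable_fst
  have hm2 : Measurable fun q : ℝ × ℝ => g q.2 := hg.comp measurable_snd
  have hm12 : Measurable fun q : ℝ × ℝ => g q.1 * g q.2 := hm1.mul hm2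
  -- `h w` is the conditional expectation of either component given `W = w`; the covariance will
  -- turn out to be `Var h(W)`.
  set h : ℝ → ℝ := fun w => ∫ u, g (u + w) ∂μ with hh
  have i12 := transferI _ hm12 (hgX.integrable_mul hgY)
  have i1 := transferI _ hm1 (hgX.integrable one_le_two)
  have i2 := transferI _ hm2 (hgY.integrable one_le_two)
  have e12 : ∀ w, ∫ p : ℝ × ℝ, g (p.1 + w) * g (p.2 + w) ∂(μ.prod μ) = h w ^ 2 := by
    intro w
    rw [integral_prod_mul (fun u => g (u + w)) (fun u => g (u + w)), sq]
  have e1 : ∀ w, ∫ p : ℝ × ℝ, g (p.1 + w) ∂(μ.prod μ) = h w := by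
    intro w
    simpa using integral_prod_mul (μ := μ) (ν := μ) (fun u => g (u + w)) (fun _ => (1 : ℝ))
  have e2 : ∀ w, ∫ p : ℝ × ℝ, g (p.2 + w) ∂(μ.prod μ) = h w := by
    intro w
    simpa using integral_prod_mul (μ := μ) (ν := μ) (fun _ => (1 : ℝ)) (fun u => g (u + w))
  have hh1 : Integrable h ν := by
    have := i1.integral_prod_right
    simpa only [e1] using this
  -- Square integrability of `h` comes from integrating out `U` and `V` in the integrable product
  -- `g(U + W) g(V + W)`.
  have hh2 : Integrable (fun w => h w ^ 2) ν := by
    have := i12.integral_prod_right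
    simpa only [e12] using this
  have hhL2 : MemLp h 2 ν := (memLp_two_iff_integrable_sq hh1.aestronglyMeasurable).2 hh2
  rw [covariance_eq_sub hgX hgY]
  have t12 := transfer _ hm12
  have t1 := transfer _ hm1
  have t2 := transfer _ hm2
  rw [integral_prod_symm _ i12] at t12
  rw [integral_prod_symm _ i1] at t1
  rw [integral_prod_symm _ i2] at t2
  simp only [e12, e1, e2] at t12 t1 t2
  have hv := variance_nonneg h ν
  rw [variance_eq_sub hhL2] at hv
  simp only [Pi.mul_apply, Pi.pow_apply] at hv ⊢
  rw [t12, t1, t2]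
  linarith [sq (∫ w, h w ∂ν)]

/-! ### Gaussian pairs with nonnegative covariance -/

/-- Characteristic functions agree: on both sides the form `p x + q y` is centered Gaussian with
variance `(p² + q²) a + (p + q)² b`. -/
lemma map_prodMk_eq_commonSummandLaw_of_gaussian {Ω : Type*} [MeasurableSpace Ω] {P : Measure Ω}
    [IsProbabilityMeasure P] {X Y : Ω → ℝ} (hXY : HasGaussianLaw (fun ω => (X ω, Y ω)) P)
    (hX0 : ∫ ω, X ω ∂P = 0) (hY0 : ∫ ω, Y ω ∂P = 0)
    {a b : NNReal} (hX : variance X P = a + b) (hY : variance Y P = a + b)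
    (hc : covariance X Y P = b) :
    P.map (fun ω => (X ω, Y ω)) = commonSummandLaw (gaussianReal 0 a) (gaussianReal 0 b) := by
  have hXL := hXY.fst.memLp_two
  have hYL := hXY.snd.memLp_two
  have : IsProbabilityMeasure (P.map (fun ω => (X ω, Y ω))) :=
    Measure.isProbabilityMeasure_map hXY.aemeasurable
  have : IsFiniteMeasure (commonSummandLaw (gaussianReal 0 a) (gaussianReal 0 b)) := by
    unfold commonSummandLaw; infer_instance
  refine Measure.ext_of_charFunDual ?_
  ext L
  set p := L (1, 0)
  set q := L (0, 1)
  have hL : ∀ x y, L (x, y) = p * x + q * y := by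
    intro x y
    have : ((x, y) : ℝ × ℝ) = x • (1, 0) + y • (0, 1) := by simp
    rw [this, map_add, map_smul, map_smul, smul_eq_mul, smul_eq_mul]; ring
  have hmean : ∫ ω, L (X ω, Y ω) ∂P = 0 := by
    simp only [hL]
    rw [integral_add ((hXL.integrable one_le_two).const_mul p)
      ((hYL.integrable one_le_two).const_mul q), integral_const_mul, integral_const_mul, hX0, hY0]
    simp
  have hvar : variance (fun ω => L (X ω, Y ω)) P
      = p ^ 2 * (a + b) + 2 * (p * q * b) + q ^ 2 * (a + b) := by
    simp only [hL]
    rw [variance_fun_add (hXL.const_mul p) (hYL.const_mul q), variance_const_mul,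
      variance_const_mul, covariance_const_mul_left, covariance_const_mul_right, hX, hY, hc]
    ring
  rw [hXY.charFunDual_map_eq_fun, hmean, hvar, charFunDual_apply, commonSummandLaw,
    integral_map measurable_commonSummand.aemeasurable
      (by fun_prop)]
  have hsplit : ∀ z : (ℝ × ℝ) × ℝ,
      Complex.exp (L (z.1.1 + z.2, z.1.2 + z.2) * Complex.I)
        = (Complex.exp (p * z.1.1 * Complex.I) * Complex.exp (q * z.1.2 * Complex.I)) *
          Complex.exp ((p + q : ℝ) * z.2 * Complex.I) := by
    intro z
    rw [← Complex.exp_add, ← Complex.exp_add, hL]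
    congr 1
    push_cast
    ring
  simp only [hsplit]
  rw [integral_prod_mul (fun z : ℝ × ℝ => Complex.exp (p * z.1 * Complex.I) *
      Complex.exp (q * z.2 * Complex.I)) (fun w : ℝ => Complex.exp ((p + q : ℝ) * w * Complex.I)),
    integral_prod_mul (fun u : ℝ => Complex.exp (p * u * Complex.I))
      (fun u : ℝ => Complex.exp (q * u * Complex.I)),
    ← charFun_apply_real, ← charFun_apply_real, ← charFun_apply_real, charFun_gaussianReal,
    charFun_gaussianReal, charFun_gaussianReal, ← Complex.exp_add, ← Complex.exp_add]
  congr 1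
  push_cast
  ring

/-- The common summand carries the covariance `c ≥ 0` as its variance. The remainders get `Var X -
c`, which is nonnegative because `Var (X - Y) = 2 (Var X - c)`. -/
lemma exists_commonSummandLaw_of_gaussian {Ω : Type*} [MeasurableSpace Ω] {P : Measure Ω}
    [IsProbabilityMeasure P] {X Y : Ω → ℝ} (hXY : HasGaussianLaw (fun ω => (X ω, Y ω)) P)
    (hX0 : ∫ ω, X ω ∂P = 0) (hY0 : ∫ ω, Y ω ∂P = 0)
    (hvar : variance X P = variance Y P) (hc : 0 ≤ covariance X Y P) :
    ∃ μ ν : Measure ℝ, IsProbabilityMeasure μ ∧ IsProbabilityMeasure ν ∧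
      P.map (fun ω => (X ω, Y ω)) = commonSummandLaw μ ν := by
  have hXL := hXY.fst.memLp_two
  have hYL := hXY.snd.memLp_two
  have hle : covariance X Y P ≤ variance X P := by
    have h := variance_nonneg (X - Y) P
    rw [variance_sub hXL hYL, ← hvar] at h
    linarith
  have hsum : variance X P
      = (variance X P - covariance X Y P).toNNReal + (covariance X Y P).toNNReal := by
    rw [Real.coe_toNNReal _ (sub_nonneg.2 hle), Real.coe_toNNReal _ hc, sub_add_cancel]
  exact ⟨gaussianReal 0 (variance X P - covariance X Y P).toNNReal,
    gaussianReal 0 (covariance X Y P).toNNReal, inferInstance, inferInstance,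
    map_prodMk_eq_commonSummandLaw_of_gaussian hXY hX0 hY0 hsum (hvar ▸ hsum)
      (Real.coe_toNNReal _ hc).symm⟩

/-! ### Lévy noise -/

section Levy

variable {Ω : Type*} [MeasurableSpace Ω] {d : ℕ} {P : Measure Ω}
  {Psi : ℝ → Measure ℝ} {L : Set (EuclideanSpace ℝ (Fin d)) → Ω → ℝ}

/-- Additivity for the constant sequence `∅` makes `N * L ∅` converge, so its increments `L ∅` tend
to zero. -/
lemma IsLevyNoise.apply_empty (hL : IsLevyNoise P Psi L) : L ∅ =ᵐ[P] 0 := by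
  have h := hL.additive (fun _ => ∅) (fun _ => .empty) (fun _ _ _ => by simp) (by simp)
  filter_upwards [h] with ω hω
  simp only [Set.iUnion_empty, Finset.sum_const, Finset.card_range, nsmul_eq_mul] at hω
  have h2 : Tendsto (fun N : ℕ => ((N + 1 : ℕ) : ℝ) * L ∅ ω - (N : ℝ) * L ∅ ω) atTop
      (𝓝 (L ∅ ω - L ∅ ω)) := (hω.comp (tendsto_add_atTop_nat 1)).sub hω
  have h3 : (fun N : ℕ => ((N + 1 : ℕ) : ℝ) * L ∅ ω - (N : ℝ) * L ∅ ω) = fun _ => L ∅ ω := by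
    ext N; push_cast; ring
  rw [h3, sub_self] at h2
  exact tendsto_nhds_unique tendsto_const_nhds h2

lemma IsLevyNoise.apply_union (hL : IsLevyNoise P Psi L) {A B : Set (EuclideanSpace ℝ (Fin d))}
    (hA : MeasurableSet A) (hB : MeasurableSet B) (hAB : Disjoint A B) (hfA : volume A < ⊤)
    (hfB : volume B < ⊤) : L (A ∪ B) =ᵐ[P] L A + L B := by
  set S : ℕ → Set (EuclideanSpace ℝ (Fin d)) := fun n => if n = 0 then A else if n = 1 then B else ∅
    with hS
  have hU : ⋃ i, S i = A ∪ B := by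
    ext x
    simp only [Set.mem_iUnion, Set.mem_union, hS]
    constructor
    · rintro ⟨i, hi⟩
      split_ifs at hi
      · exact .inl hi
      · exact .inr hi
      · exact hi.elim
    · rintro (h | h)
      · exact ⟨0, by simpa using h⟩
      · exact ⟨1, by simpa using h⟩
  have h := hL.additive S (fun i => by simp only [hS]; split_ifs <;> first | assumption | simp)
    (fun i j hij => by
      simp only [hS]
      split_ifs <;> first | omega | exact hAB | exact hAB.symm | simp)
    (by rw [hU]; exact (measure_union_le _ _).trans_lt (ENNReal.add_lt_top.2 ⟨hfA, hfB⟩))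
  rw [hU] at h
  filter_upwards [h, hL.apply_empty] with ω hω h0
  refine tendsto_nhds_unique hω (tendsto_const_nhds.congr' ?_)
  filter_upwards [eventually_ge_atTop 2] with N hN
  obtain ⟨M, rfl⟩ := Nat.exists_eq_add_of_le' hN
  rw [Finset.sum_range_succ', Finset.sum_range_succ', Finset.sum_eq_zero]
  · simp [hS, add_comm]
  · intro i _
    simpa [hS] using h0

lemma IsLevyNoise.indepFun (hL : IsLevyNoise P Psi L) {A B : Set (EuclideanSpace ℝ (Fin d))}
    (hA : MeasurableSet A) (hB : MeasurableSet B) (hAB : Disjoint A B) (hfA : volume A < ⊤)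
    (hfB : volume B < ⊤) : IndepFun (L A) (L B) P := by
  have h := hL.independent 2 ![A, B] (by simp [Fin.forall_fin_two, hA, hB])
    (by simp [Fin.forall_fin_two, hfA, hfB])
    (fun i j hij => by fin_cases i <;> fin_cases j <;> simp_all [hAB.symm])
  simpa using h.indepFun (i := 0) (j := 1) (by simp)

variable [IsProbabilityMeasure P]

/-- A square integrable noise vanishes almost surely on Lebesgue null sets. -/
lemma IsLevyNoise.apply_null (hL : IsLevyNoise P Psi L)
    (hPsi : ∀ lam, 0 < lam → MemLp (id : ℝ → ℝ) 2 (Psi lam))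
    {B N : Set (EuclideanSpace ℝ (Fin d))} (hB : MeasurableSet B) (hB0 : 0 < volume B)
    (hfB : volume B < ⊤) (hN : MeasurableSet N) (hN0 : volume N = 0) : L N =ᵐ[P] 0 := by
  -- `law` is silent on null sets. But `A` and `A ∪ N` have the same positive volume, hence `L A`
  -- and `L A + L N` have the same law; with independence, `L N` has mean and variance zero.
  set A := B \ N
  have hA : MeasurableSet A := hB.diff hN
  have hvA : volume A = volume B := measure_sdiff_null hN0
  have hAN : Disjoint A N := Set.disjoint_sdiff_left
  have hfA : volume A < ⊤ := hvA ▸ hfB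
  have hfN : volume N < ⊤ := by simp [hN0]
  have hvU : volume (A ∪ N) = volume A := by
    rw [measure_union hAN hN, hN0, add_zero]
  have hmA := hL.measurable A hA hfA
  have hmN := hL.measurable N hN hfN
  have hmU := hL.measurable (A ∪ N) (hA.union hN) (hvU ▸ hfA)
  have hlawA := hL.law A hA (hvA ▸ hB0) hfA
  have hlawU := hL.law (A ∪ N) (hA.union hN) (by rw [hvU, hvA]; exact hB0) (hvU ▸ hfA)
  rw [hvU, ← hlawA] at hlawU
  have hident : IdentDistrib (L (A ∪ N)) (L A) P P := ⟨hmU.aemeasurable, hmA.aemeasurable, hlawU⟩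
  have hAL : MemLp (L A) 2 P := by
    have := hPsi (volume A).toReal (ENNReal.toReal_pos (by rw [hvA]; exact hB0.ne') hfA.ne)
    rw [← hlawA] at this
    exact (memLp_map_measure_iff aestronglyMeasurable_id hmA.aemeasurable).1 this
  have hUL : MemLp (L (A ∪ N)) 2 P := hident.symm.memLp_iff.1 hAL
  have hadd := hL.apply_union hA hN hAN hfA hfN
  have hNL : MemLp (L N) 2 P := by
    refine (hUL.sub hAL).ae_eq ?_
    filter_upwards [hadd] with ω h
    simp [h]
  have hind := hL.indepFun hA hN hAN hfA hfN
  have hmean : ∫ ω, L N ω ∂P = 0 := by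
    have h1 := hident.integral_eq
    rw [integral_congr_ae hadd] at h1
    simp only [Pi.add_apply] at h1
    rw [integral_add (hAL.integrable one_le_two) (hNL.integrable one_le_two)] at h1
    linarith
  have hvar : variance (L N) P = 0 := by
    have h1 := hident.variance_eq
    rw [variance_congr hadd, hind.variance_add hAL hNL] at h1
    linarith
  rw [variance_of_integral_eq_zero hmN.aemeasurable hmean] at hvar
  have := (integral_eq_zero_iff_of_nonneg (fun ω => sq_nonneg _) hNL.integrable_sq).1 hvar
  filter_upwards [this] with ω hω
  exact pow_eq_zero_iff two_ne_zero |>.1 hω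

lemma IsLevyNoise.map_eq_of_volume_eq (hL : IsLevyNoise P Psi L)
    (hPsi : ∀ lam, 0 < lam → MemLp (id : ℝ → ℝ) 2 (Psi lam))
    {B : Set (EuclideanSpace ℝ (Fin d))} (hB : MeasurableSet B) (hB0 : 0 < volume B)
    (hfB : volume B < ⊤) {A C : Set (EuclideanSpace ℝ (Fin d))} (hA : MeasurableSet A)
    (hC : MeasurableSet C) (hfA : volume A < ⊤) (hAC : volume A = volume C) :
    P.map (L A) = P.map (L C) := by
  rcases eq_or_ne (volume A) 0 with h0 | h0
  · exact Measure.map_congr ((hL.apply_null hPsi hB hB0 hfB hA h0).trans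
      (hL.apply_null hPsi hB hB0 hfB hC (hAC ▸ h0)).symm)
  · have hpos := pos_iff_ne_zero.2 h0
    rw [hL.law A hA hpos hfA, hL.law C hC (hAC ▸ hpos) (hAC ▸ hfA), hAC]

/-- Take `W = L (A ∩ B)`, `U = L (A \ B)`, `V = L (B \ A)`. Equal volumes of `A` and `B` give equal
volumes of the two differences, hence equal laws; the differences may be null, which is why
`map_eq_of_volume_eq` covers that case. -/
lemma IsLevyNoise.exists_commonSummandLaw (hL : IsLevyNoise P Psi L)
    (hPsi : ∀ lam, 0 < lam → MemLp (id : ℝ → ℝ) 2 (Psi lam))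
    {A B : Set (EuclideanSpace ℝ (Fin d))} (hA : MeasurableSet A) (hB : MeasurableSet B)
    (hA0 : 0 < volume A) (hfA : volume A < ⊤) (hAB : volume A = volume B) :
    ∃ μ ν : Measure ℝ, IsProbabilityMeasure μ ∧ IsProbabilityMeasure ν ∧
      P.map (fun ω => (L A ω, L B ω)) = commonSummandLaw μ ν := by
  have hfB : volume B < ⊤ := hAB ▸ hfA
  have hD1 := hA.diff hB
  have hD2 := hB.diff hA
  have hI := hA.inter hB
  have hf1 : volume (A \ B) < ⊤ := (measure_mono Set.sdiff_subset).trans_lt hfA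
  have hf2 : volume (B \ A) < ⊤ := (measure_mono Set.sdiff_subset).trans_lt hfB
  have hfI : volume (A ∩ B) < ⊤ := (measure_mono Set.inter_subset_left).trans_lt hfA
  have hd1 : Disjoint (A \ B) (A ∩ B) := Set.disjoint_sdiff_inter
  have hd2 : Disjoint (B \ A) (A ∩ B) := by
    rw [Set.inter_comm]; exact Set.disjoint_sdiff_inter
  have hd12 : Disjoint (A \ B) (B \ A) := disjoint_sdiff_sdiff
  have hvol : volume (A \ B) = volume (B \ A) := by
    have h1 := measure_sdiff_add_inter (μ := volume) A hB
    have h2 := measure_sdiff_add_inter (μ := volume) B hA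
    rw [Set.inter_comm] at h2
    rw [hAB, ← h2] at h1
    exact (ENNReal.add_left_inj hfI.ne).1 h1
  have hmap := hL.map_eq_of_volume_eq hPsi hA hA0 hfA hD1 hD2 hf1 hvol
  have hm1 := hL.measurable _ hD1 hf1
  have hm2 := hL.measurable _ hD2 hf2
  have hmI := hL.measurable _ hI hfI
  refine ⟨P.map (L (A \ B)), P.map (L (A ∩ B)), Measure.isProbabilityMeasure_map hm1.aemeasurable,
    Measure.isProbabilityMeasure_map hmI.aemeasurable, ?_⟩
  have hiI : iIndepFun (fun i : Fin 3 => L (![A \ B, B \ A, A ∩ B] i)) P := by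
    refine hL.independent 3 ![A \ B, B \ A, A ∩ B] (fun i => ?_) (fun i => ?_) (fun i j hij => ?_)
    · fin_cases i <;> assumption
    · fin_cases i <;> assumption
    · fin_cases i <;> fin_cases j <;>
        first | exact absurd rfl hij | assumption | exact Disjoint.symm (by assumption)
  have hmeas : ∀ i : Fin 3, Measurable (L (![A \ B, B \ A, A ∩ B] i)) := fun i => by
    fin_cases i <;> assumption
  have h12 : IndepFun (L (A \ B)) (L (B \ A)) P := hiI.indepFun (i := 0) (j := 1) (by simp)
  have h12I : IndepFun (fun ω => (L (A \ B) ω, L (B \ A) ω)) (L (A ∩ B)) P :=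
    hiI.indepFun_prodMk hmeas 0 1 2 (by simp) (by simp)
  have hjoint : P.map (fun ω => ((L (A \ B) ω, L (B \ A) ω), L (A ∩ B) ω))
      = ((P.map (L (A \ B))).prod (P.map (L (A \ B)))).prod (P.map (L (A ∩ B))) := by
    rw [(indepFun_iff_map_prod_eq_prod_map_map (hm1.prodMk hm2).aemeasurable hmI.aemeasurable).1
      h12I, (indepFun_iff_map_prod_eq_prod_map_map hm1.aemeasurable hm2.aemeasurable).1 h12, ← hmap]
  rw [commonSummandLaw, ← hjoint,
    Measure.map_map measurable_commonSummand ((hm1.prodMk hm2).prodMk hmI)]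
  refine Measure.map_congr ?_
  have hu1 := hL.apply_union hD1 hI hd1 hf1 hfI
  have hu2 := hL.apply_union hD2 hI hd2 hf2 hfI
  rw [Set.sdiff_union_inter] at hu1
  rw [Set.inter_comm, Set.sdiff_union_inter, Set.inter_comm] at hu2
  filter_upwards [hu1, hu2] with ω h1 h2
  simp [h1, h2]

end Levy

/-! ### Stationary fields -/

section Stationary

variable {Ω : Type*} [MeasurableSpace Ω] {d : ℕ} {P : Measure Ω}
  {X : EuclideanSpace ℝ (Fin d) → Ω → ℝ}

lemma IsMeasurableField.measurable (hmeas : IsMeasurableField X) (t : EuclideanSpace ℝ (Fin d)) :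
    Measurable (X t) :=
  Measurable.comp (g := fun p : EuclideanSpace ℝ (Fin d) × Ω => X p.1 p.2) hmeas
    measurable_prodMk_left

lemma IsStationaryField.identDistrib_pair (hstat : IsStationaryField P X)
    (hmeas : IsMeasurableField X) (s t h : EuclideanSpace ℝ (Fin d)) :
    IdentDistrib (fun ω => (X (s + h) ω, X (t + h) ω)) (fun ω => (X s ω, X t ω)) P P := by
  have hm := hmeas.measurable
  have h1 : IdentDistrib (fun ω (i : Fin 2) => X (![s, t] i + h) ω)
      (fun ω (i : Fin 2) => X (![s, t] i) ω) P P :=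
    ⟨(measurable_pi_lambda _ fun i => hm _).aemeasurable,
      (measurable_pi_lambda _ fun i => hm _).aemeasurable, hstat 2 ![s, t] h⟩
  simpa [Function.comp_def] using
    h1.comp (u := fun v : Fin 2 → ℝ => (v 0, v 1)) (by fun_prop)

lemma IsStationaryField.identDistrib (hstat : IsStationaryField P X)
    (hmeas : IsMeasurableField X) (t : EuclideanSpace ℝ (Fin d)) :
    IdentDistrib (X t) (X 0) P P := by
  simpa [Function.comp_def] using (hstat.identDistrib_pair hmeas 0 0 t).comp measurable_fst

lemma IsStationaryField.covariance_eq (hstat : IsStationaryField P X)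
    (hmeas : IsMeasurableField X) {f g : ℝ → ℝ} (hf : Measurable f) (hg : Measurable g)
    (s t : EuclideanSpace ℝ (Fin d)) :
    covariance (fun ω => f (X s ω)) (fun ω => g (X t ω)) P
      = covariance (fun ω => f (X 0 ω)) (fun ω => g (X (t - s) ω)) P := by
  have ef : ∫ ω, f (X s ω) ∂P = ∫ ω, f (X 0 ω) ∂P :=
    ((hstat.identDistrib hmeas s).comp hf).integral_eq
  have eg : ∫ ω, g (X t ω) ∂P = ∫ ω, g (X (t - s) ω) ∂P :=
    (((hstat.identDistrib hmeas t).trans (hstat.identDistrib hmeas (t - s)).symm).comp hg).integral_eq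
  have hp := hstat.identDistrib_pair hmeas 0 (t - s) s
  rw [zero_add, sub_add_cancel] at hp
  unfold covariance
  rw [ef, eg]
  exact (hp.comp (u := fun p : ℝ × ℝ => (f p.1 - ∫ ω, f (X 0 ω) ∂P) *
    (g p.2 - ∫ ω, g (X (t - s) ω) ∂P)) (by fun_prop)).integral_eq

/-- Stationarity gives `Cov(f_j(X 0), f_i(X (-t))) = Cov(f_i(X 0), f_j(X t))`; substitute `t ↦ -t`
in the integral. -/
lemma isHermitian_asympCov (hmeas : IsMeasurableField X) (hstat : IsStationaryField P X) {s : ℕ}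
    {f : Fin s → ℝ → ℝ} (hf : ∀ i, Measurable (f i)) : (asympCov P X f).IsHermitian := by
  ext i j
  simp only [asympCov, Matrix.conjTranspose_apply, Matrix.of_apply, star_trivial]
  rw [← integral_neg_eq_self]
  refine integral_congr_ae (.of_forall fun t => ?_)
  simp only
  rw [covariance_comm, hstat.covariance_eq hmeas (hf i) (hf j)]
  simp

variable [IsProbabilityMeasure P]

/-- For a measurable stationary field, a nonnegative integrable covariance function has positive
integral unless the variance vanishes. -/
lemma IsStationaryField.integral_covariance_pos (hstat : IsStationaryField P X)
    (hmeas : IsMeasurableField X) {g : ℝ → ℝ} (hg : Measurable g)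
    (hL2 : MemLp (fun ω => g (X 0 ω)) 2 P)
    (hint : Integrable (fun t => covariance (fun ω => g (X 0 ω)) (fun ω => g (X t ω)) P) volume)
    (hnonneg : ∀ t, 0 ≤ covariance (fun ω => g (X 0 ω)) (fun ω => g (X t ω)) P)
    (hvar : 0 < variance (fun ω => g (X 0 ω)) P) :
    0 < ∫ t, covariance (fun ω => g (X 0 ω)) (fun ω => g (X t ω)) P := by
  refine (integral_nonneg hnonneg).lt_of_ne fun h0 => hvar.ne' ?_
  have hK := (integral_eq_zero_iff_of_nonneg hnonneg hint).1 h0.symm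
  have hid : ∀ t, IdentDistrib (fun ω => g (X t ω)) (fun ω => g (X 0 ω)) P P := fun t =>
    (hstat.identDistrib hmeas t).comp hg
  have hgL2 : ∀ t, MemLp (fun ω => g (X t ω)) 2 P := fun t => (hid t).symm.memLp_iff.1 hL2
  set m := ∫ ω, g (X 0 ω) ∂P
  have hm : ∀ t, ∫ ω, g (X t ω) ∂P = m := fun t => (hid t).integral_eq
  have hcov : ∀ s t, ∫ ω, (g (X s ω) - m) * (g (X t ω) - m) ∂P
      = covariance (fun ω => g (X s ω)) (fun ω => g (X t ω)) P := by
    intro s t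
    rw [covariance, hm, hm]
  -- The ball only serves as an index set of finite positive measure.
  set μ := (volume : Measure (EuclideanSpace ℝ (Fin d))).restrict (Metric.closedBall 0 1)
  have : IsFiniteMeasure μ := isFiniteMeasure_restrict.2 measure_closedBall_lt_top.ne
  have hZ := ae_eq_zero_of_ae_orthogonal (μ := μ) (P := P) (Z := fun t ω => g (X t ω) - m)
    ((hg.comp hmeas).sub_const m) (fun t => (hgL2 t).sub (memLp_const m))
    (variance (fun ω => g (X 0 ω)) P)
    (fun t => by
      rw [← (hid t).variance_eq, variance_eq_integral (hgL2 t).aemeasurable, hm])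
    (fun s => by
      refine ae_restrict_of_ae ?_
      -- The exceptional null set for index `s` is the translate by `s` of the one for index `0`.
      have h1 := (measurePreserving_sub_right (volume : Measure (EuclideanSpace ℝ (Fin d)))
        s).quasiMeasurePreserving.ae hK
      filter_upwards [h1] with t ht
      rw [hcov, hstat.covariance_eq hmeas hg hg]
      exact ht)
  have hμ : μ ≠ 0 := by
    rw [Ne, Measure.restrict_eq_zero]
    exact (Metric.measure_closedBall_pos _ _ one_pos).ne'
  have : (ae μ).NeBot := ae_neBot.2 hμ
  -- A single `t` with `Z_t = 0` almost surely suffices, since the variance does not depend on `t`.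
  obtain ⟨t, ht⟩ := (Measure.ae_ae_of_ae_prod hZ).exists
  rw [← (hid t).variance_eq, variance_eq_integral (hgL2 t).aemeasurable, hm]
  refine integral_eq_zero_of_ae ?_
  filter_upwards [ht] with ω hω
  simp only [Pi.zero_apply] at hω ⊢
  rw [hω]; simp

lemma exists_commonSummandLaw_of_gaussian_or_levyMeixner (hmeas : IsMeasurableField X)
    (hstat : IsStationaryField P X)
    (hX : IsCenteredGaussianNonnegCov P X ∨ IsLevyMeixnerField P X)
    (t : EuclideanSpace ℝ (Fin d)) :
    ∃ μ ν : Measure ℝ, IsProbabilityMeasure μ ∧ IsProbabilityMeasure ν ∧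
      P.map (fun ω => (X 0 ω, X t ω)) = commonSummandLaw μ ν := by
  rcases hX with ⟨hG, h0, hc⟩ | ⟨Psi, Q, L, B, hS, hL, hB, hB0, hfB, hXL⟩
  · exact exists_commonSummandLaw_of_gaussian hG.hasGaussianLaw_prodMk (h0 0) (h0 t)
      (hstat.identDistrib hmeas t).variance_eq.symm (hc 0 t)
  · have hPsi : ∀ lam, 0 < lam → MemLp (id : ℝ → ℝ) 2 (Psi lam) := fun lam hlam =>
      (memLp_two_iff_integrable_sq aestronglyMeasurable_id).2 (hS.integrable_pow lam hlam 2)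
    have himg : ∀ t, (fun x => x + t) '' B = (fun x => x - t) ⁻¹' B := by
      intro t
      rw [Set.image_add_right]
      simp [sub_eq_add_neg]
    have hmB : ∀ t, MeasurableSet ((fun x => x + t) '' B) := fun t => by
      rw [himg]; exact (measurable_sub_const t) hB
    have hvB : ∀ t, volume ((fun x => x + t) '' B) = volume B := fun t => by
      rw [himg]
      exact (measurePreserving_sub_right volume t).measure_preimage hB.nullMeasurableSet
    -- The windows at `0` and `t` are translates of `B`, hence of equal volume.
    obtain ⟨μ, ν, hμ, hν, h⟩ := hL.exists_commonSummandLaw hPsi (hmB 0) (hmB t)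
      (by rwa [hvB]) (by rwa [hvB]) (by rw [hvB, hvB])
    refine ⟨μ, ν, hμ, hν, ?_⟩
    rw [← h]
    refine Measure.map_congr ?_
    filter_upwards [hXL 0, hXL t] with ω h1 h2
    rw [h1, h2]

lemma dotProduct_asympCov_mulVec {s : ℕ} {f : Fin s → ℝ → ℝ}
    (hL2 : ∀ i t, MemLp (fun ω => f i (X t ω)) 2 P)
    (hcov : ∀ i j, Integrable
      (fun t => covariance (fun ω => f i (X 0 ω)) (fun ω => f j (X t ω)) P) volume)
    (u : Fin s → ℝ) :
    Integrable (fun t => covariance (fun ω => ∑ i, u i * f i (X 0 ω))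
      (fun ω => ∑ i, u i * f i (X t ω)) P) volume ∧
    dotProduct u ((asympCov P X f).mulVec u) = ∫ t, covariance (fun ω => ∑ i, u i * f i (X 0 ω))
      (fun ω => ∑ i, u i * f i (X t ω)) P := by
  have hexp : ∀ t, covariance (fun ω => ∑ i, u i * f i (X 0 ω))
      (fun ω => ∑ i, u i * f i (X t ω)) P
      = ∑ i, ∑ j, u i * (covariance (fun ω => f i (X 0 ω)) (fun ω => f j (X t ω)) P * u j) := by
    intro t
    rw [covariance_fun_sum_fun_sum (fun i => (hL2 i 0).const_mul (u i))
      (fun j => (hL2 j t).const_mul (u j))]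
    refine Finset.sum_congr rfl fun i _ => Finset.sum_congr rfl fun j _ => ?_
    rw [covariance_const_mul_left, covariance_const_mul_right]
    ring
  have hI : ∀ i j, Integrable (fun t => u i *
      (covariance (fun ω => f i (X 0 ω)) (fun ω => f j (X t ω)) P * u j)) volume := fun i j =>
    ((hcov i j).mul_const (u j)).const_mul (u i)
  simp only [hexp]
  refine ⟨integrable_finsetSum _ fun i _ => integrable_finsetSum _ fun j _ => hI i j, ?_⟩
  rw [integral_finsetSum _ fun i _ => integrable_finsetSum _ fun j _ => hI i j]
  simp only [dotProduct, Matrix.mulVec, asympCov, Matrix.of_apply, Finset.mul_sum]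
  refine Finset.sum_congr rfl fun i _ => ?_
  rw [integral_finsetSum _ fun j _ => hI i j]
  refine Finset.sum_congr rfl fun j _ => ?_
  rw [integral_const_mul, integral_mul_const]

end Stationary

lemma memLp_two_of_integrable_rpow {Ω : Type*} [MeasurableSpace Ω] {P : Measure Ω}
    [IsFiniteMeasure P] {Y : Ω → ℝ} (hY : Measurable Y) {del : ℝ} (hdel : 0 < del)
    (h : Integrable (fun ω => |Y ω| ^ (2 + del)) P) : MemLp Y 2 P := by
  have h1 : MemLp Y (ENNReal.ofReal (2 + del)) P := by
    rw [← integrable_norm_rpow_iff hY.aestronglyMeasurable (by simp; linarith) (by simp),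
      ENNReal.toReal_ofReal (by linarith)]
    exact h
  refine h1.mono_exponent ?_
  rw [← ENNReal.ofReal_ofNat]
  exact ENNReal.ofReal_le_ofReal (by linarith)

end RandomFieldCLT

theorem proposition4p3 {Ω : Type*} [MeasurableSpace Ω] (P : Measure Ω) [IsProbabilityMeasure P]
    {d : ℕ} (hd : 0 < d) (X : EuclideanSpace ℝ (Fin d) → Ω → ℝ)
    (hmeas : RandomFieldCLT.IsMeasurableField X)
    (hstat : RandomFieldCLT.IsStationaryField P X)
    {s : ℕ} (f : Fin s → ℝ → ℝ) (hf : ∀ i, Measurable (f i))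
    (del : ℝ) (hdel : 0 < del)
    (hmom : ∀ i, Integrable (fun ω => |f i (X 0 ω)| ^ (2 + del)) P)
    (hcov : ∀ i j, Integrable
      (fun t => covariance (fun ω => f i (X 0 ω)) (fun ω => f j (X t ω)) P) volume)
    (hmix : RandomFieldCLT.MixingCondition P X del)
    (hX : RandomFieldCLT.IsCenteredGaussianNonnegCov P X ∨ RandomFieldCLT.IsLevyMeixnerField P X) :
    (∀ u : Fin s → ℝ, 0 < variance (fun ω => ∑ i, u i * f i (X 0 ω)) P →
      0 < dotProduct u ((RandomFieldCLT.asympCov P X f).mulVec u)) ∧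
    (∀ i, 0 < variance (fun ω => f i (X 0 ω)) P → 0 < RandomFieldCLT.asympCov P X f i i) ∧
    ((∀ u : Fin s → ℝ, variance (fun ω => ∑ i, u i * f i (X 0 ω)) P = 0 → u = 0) →
      (RandomFieldCLT.asympCov P X f).PosDef) := by
  have hL2 : ∀ i t, MemLp (fun ω => f i (X t ω)) 2 P := fun i t =>
    ((hstat.identDistrib hmeas t).comp (hf i)).symm.memLp_iff.1
      (RandomFieldCLT.memLp_two_of_integrable_rpow ((hf i).comp (hmeas.measurable 0)) hdel (hmom i))
  have hpos : ∀ u : Fin s → ℝ, 0 < variance (fun ω => ∑ i, u i * f i (X 0 ω)) P →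
      0 < dotProduct u ((RandomFieldCLT.asympCov P X f).mulVec u) := by
    intro u hu
    obtain ⟨hI, he⟩ := RandomFieldCLT.dotProduct_asympCov_mulVec hL2 hcov u
    have hg : Measurable fun x => ∑ i, u i * f i x :=
      Finset.measurable_fun_sum _ fun i _ => (hf i).const_mul (u i)
    have hgL2 : ∀ t, MemLp (fun ω => ∑ i, u i * f i (X t ω)) 2 P := fun t =>
      memLp_finsetSum _ fun i _ => (hL2 i t).const_mul (u i)
    rw [he]
    refine hstat.integral_covariance_pos hmeas hg (hgL2 0) hI (fun t => ?_) hu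
    obtain ⟨μ, ν, hμ, hν, hlaw⟩ :=
      RandomFieldCLT.exists_commonSummandLaw_of_gaussian_or_levyMeixner hmeas hstat hX t
    exact RandomFieldCLT.covariance_nonneg_of_commonSummand (hmeas.measurable 0)
      (hmeas.measurable t) hlaw hg (hgL2 0) (hgL2 t)
  refine ⟨hpos, fun i hi => ?_, fun h => ?_⟩
  · have := hpos (Pi.single i 1) (by simpa [Pi.single_apply] using hi)
    simpa using this
  · refine Matrix.PosDef.of_dotProduct_mulVec_pos
      (RandomFieldCLT.isHermitian_asympCov hmeas hstat hf) fun u hu => ?_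
    rw [star_trivial]
    exact hpos u ((variance_nonneg _ _).lt_of_ne fun h0 => hu (h u h0.symm))
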